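/- For a permutation $\sigma$ of $\{0,1,\dots,b-1\}$, written as the tuple $(\sigma(0),\dots,\sigma(b-1))$, and a sequence $X=(x_n)_{n\ge 0}$ in $[0,1)$, let $A([\alpha,\beta),N,X)=\#\{0\le i\le N-1:\alpha\le x_i<\beta\}$ (defined likewise for finite tuples $X$ of length at least $N$). **Discrepancy and van der Corput sequences.** For $N\ge 1$ let $N D_N(X)=\sup_{0\le\alpha<\beta\le 1}|A([\alpha,\beta),N,X)-(\beta-\alpha)N|$. Let $a_j(n)$ be the $j$-th digit of $n$ in base $b$ (so $n=\sum_{j\ge0}a_j(n)b^j$, $0\le a_j(n)<b$), let $S_b(n)=\sum_{j\ge 0}a_j(n)b^{-j-1}$ and $S_b^\sigma(n)=\sum_{j\ge 0}\sigma(a_j(n))b^{-j-1}$, and let $\mathcal S_b=(S_b(n))_{n\ge0}$, $\mathcal S_b^\sigma=(S_b^\sigma(n))_{n\ge0}$; $\mathcal S_2$ is the classical van der Corput sequence. **The functions $\psi_b^\sigma$.** Let $\mathcal X_b^\sigma=(\sigma(0)/b,\dots,\sigma(b-1)/b)$. For $0\le h<b$, $1\le k\le b$ and $x\in[\frac{k-1}{b},\frac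 kb)$ put $\varphi_{b,h}^\sigma(x)=A([0,h/b),k,\mathcal X_b^\sigma)-hx$ if $h\le\sigma(k-1)$ and $\varphi_{b,h}^\sigma(x)=(b-h)x-A([h/b,1),k,\mathcal X_b^\sigma)$ if $h>\sigma(k-1)$, and extend $\varphi_{b,h}^\sigma$ to $\mathbb R$ with period $1$. Let $\psi_b^\sigma=\max_{0\le h<b}\varphi_{b,h}^\sigma+\max_{0\le h<b}(-\varphi_{b,h}^\sigma)$. **The permutations.** Let $\mathcal P_1=\{(0,1)\}$ and, for $m\ge1$, let $\mathcal P_{m+1}$ be the set of all permutations $(2\sigma,2\sigma'\oplus a)$ of $\{0,\dots,2^{m+1}-1\}$ with $\sigma,\sigma'\in\mathcal P_m$ and $a$ odd, $1\le a\le 2^{m+1}$; here $2\sigma$ is the tuple of the numbers $2\sigma(i)$, $2\sigma'\oplus a$ is the tuple of the numbers $2\sigma'(i)+a$ reduced modulo $2^{m+1}$, and $(\cdot,\cdot)$ is concatenation. For permutations $\sigma$ of $\{0,\dots,b-1\}$ and $\tau$ of $\{0,\dots,c-1\}$ the intrication $\sigma\cdot\tau$ is the permutation of $\{0,\dots,bc-1\}$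 with $\sigma\cdot\tau(k''b+k')=c\,\sigma(k')+\tau(k'')$ for $0\le k'<b$, $0\le k''<c$. Let $\sigma_1=(0,1)$ and $\sigma_m=\sigma_{m-1}\cdot(0,1)$ for $m\ge2$. **Statement.** For all $m\ge1$ and all $\sigma\in\mathcal P_m$: 1. $\psi_{2^m}^\sigma(x)=\psi_{2^m}^{\sigma_m}(x)$ for all $x\in[0,1]$; 2. $D_N(\mathcal S_{2^m}^\sigma)=D_N(\mathcal S_2)$ for all $N\ge1$. -/

import Mathlib

noncomputable section

namespace VanDerCorput

/-- The number of indices `0 ≤ i ≤ N - 1` with `x i ∈ [α, β)`. -/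
def count (α β : ℝ) (N : ℕ) (x : ℕ → ℝ) : ℕ :=
  Nat.card {i : ℕ // i < N ∧ α ≤ x i ∧ x i < β}

/-- The remainder `R([α, β), N, x) = A([α, β), N, x) - (β - α) N`. -/
def remainder (α β : ℝ) (N : ℕ) (x : ℕ → ℝ) : ℝ :=
  (count α β N x : ℝ) - (β - α) * N

/-- The extreme discrepancy `D_N` of the first `N` points of a sequence in `[0, 1)`:
`N D_N` is the supremum of `|R([α, β), N, x)|` over all intervals `[α, β) ⊆ [0, 1)`. -/
def discrepancy (N : ℕ) (x : ℕ → ℝ) : ℝ :=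
  sSup {r : ℝ | ∃ α β : ℝ, 0 ≤ α ∧ α < β ∧ β ≤ 1 ∧ r = |remainder α β N x|} / N

/-- The `j`-th digit `a_j(n)` of `n` in base `b`. -/
def digit (b n j : ℕ) : ℕ := n / b ^ j % b

/-- The radical inverse function `S_b`; `radicalInverse 2` is the classical van der Corput
sequence. -/
def radicalInverse (b n : ℕ) : ℝ := ∑' j : ℕ, (digit b n j : ℝ) / (b : ℝ) ^ (j + 1)

/-- A permutation of `{0, …, b - 1}` as the tuple `(σ 0, …, σ (b - 1))` of natural numbers.
Only the entries with index `i < b` are used below. -/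
def entry {b : ℕ} [NeZero b] (σ : Equiv.Perm (Fin b)) (i : ℕ) : ℕ := σ (Fin.ofNat b i)

/-- The permuted radical inverse function `S_b^σ`, that is, the permuted van der Corput
sequence generated by `σ`. -/
def permutedRadicalInverse {b : ℕ} [NeZero b] (σ : Equiv.Perm (Fin b)) (n : ℕ) : ℝ :=
  ∑' j : ℕ, (entry σ (digit b n j) : ℝ) / (b : ℝ) ^ (j + 1)

/-- The tuple `X_b^σ = (σ 0 / b, …, σ (b - 1) / b)`. -/
def pointTuple {b : ℕ} [NeZero b] (σ : Equiv.Perm (Fin b)) (i : ℕ) : ℝ :=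
  (entry σ i : ℝ) / (b : ℝ)

/-- The formula for `φ_{b,h}^σ` at a point `x ∈ [(k - 1) / b, k / b)`, where `1 ≤ k ≤ b`. -/
def phiPiece {b : ℕ} [NeZero b] (σ : Equiv.Perm (Fin b)) (h k : ℕ) (x : ℝ) : ℝ :=
  if h ≤ entry σ (k - 1) then
    (count 0 ((h : ℝ) / b) k (pointTuple σ) : ℝ) - h * x
  else
    ((b : ℝ) - h) * x - (count ((h : ℝ) / b) 1 k (pointTuple σ) : ℝ)

/-- The function `φ_{b,h}^σ`, extended from `[0, 1)` to the reals with period one.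
If `x ∈ [0, 1)` lies in `[(k - 1) / b, k / b)`, then `k = ⌊b x⌋ + 1`. -/
def phi {b : ℕ} [NeZero b] (σ : Equiv.Perm (Fin b)) (h : ℕ) (x : ℝ) : ℝ :=
  phiPiece σ h (⌊(b : ℝ) * Int.fract x⌋₊ + 1) (Int.fract x)

/-- `ψ_b^{σ,+} = max_{0 ≤ h < b} φ_{b,h}^σ`. -/
def psiPlus {b : ℕ} [NeZero b] (σ : Equiv.Perm (Fin b)) (x : ℝ) : ℝ :=
  Finset.univ.sup' Finset.univ_nonempty fun h : Fin b => phi σ h x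

/-- `ψ_b^{σ,-} = max_{0 ≤ h < b} (- φ_{b,h}^σ)`. -/
def psiMinus {b : ℕ} [NeZero b] (σ : Equiv.Perm (Fin b)) (x : ℝ) : ℝ :=
  Finset.univ.sup' Finset.univ_nonempty fun h : Fin b => -phi σ h x

/-- `ψ_b^σ = ψ_b^{σ,+} + ψ_b^{σ,-}`. -/
def psi {b : ℕ} [NeZero b] (σ : Equiv.Perm (Fin b)) (x : ℝ) : ℝ :=
  psiPlus σ x + psiMinus σ x

/-- The families `P_m` of permutations of `{0, …, 2 ^ m - 1}`, `m ≥ 1`. The set `P_1` consists of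
the tuple `(0, 1)`, and `P_{m+1}` consists of all permutations whose tuple is the concatenation
`(2 σ, 2 σ' ⊕ a)` with `σ, σ' ∈ P_m` and `a` odd, `1 ≤ a ≤ 2 ^ (m + 1)`, where `⊕` is addition
modulo `2 ^ (m + 1)`. -/
inductive Family : (m : ℕ) → Equiv.Perm (Fin (2 ^ m)) → Prop
  | one : Family 1 1
  | step (m : ℕ) (σ σ' : Equiv.Perm (Fin (2 ^ m))) (a : ℕ)
      (τ : Equiv.Perm (Fin (2 ^ (m + 1))))
      (hσ : Family m σ) (hσ' : Family m σ')
      (ha : Odd a) (ha1 : 1 ≤ a) (ha2 : a ≤ 2 ^ (m + 1))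
      (hfst : ∀ i < 2 ^ m, entry τ i = 2 * entry σ i)
      (hsnd : ∀ i < 2 ^ m, entry τ (2 ^ m + i) = (2 * entry σ' i + a) % 2 ^ (m + 1)) :
      Family (m + 1) τ

/-- The intrication `σ · τ` of permutations in bases `b` and `c`: the permutation in base `b c`
that sends `k'' b + k'` to `c σ(k') + τ(k'')` for `k' < b` and `k'' < c`. -/
def intrication {b c : ℕ} (σ : Equiv.Perm (Fin b)) (τ : Equiv.Perm (Fin c)) :
    Equiv.Perm (Fin (b * c)) :=
  (((finCongr (mul_comm b c)).trans finProdFinEquiv.symm).trans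
    ((Equiv.prodComm (Fin c) (Fin b)).trans (Equiv.prodCongr σ τ))).trans finProdFinEquiv

theorem intrication_apply {b c : ℕ} (σ : Equiv.Perm (Fin b)) (τ : Equiv.Perm (Fin c))
    (k : Fin (b * c)) (k' : Fin b) (k'' : Fin c) (hk : (k : ℕ) = k'' * b + k') :
    (intrication σ τ k : ℕ) = c * σ k' + τ k'' := by
  have h : finCongr (mul_comm b c) k = finProdFinEquiv (k'', k') := by
    apply Fin.ext
    simp [hk]
    ring
  simp only [intrication, Equiv.trans_apply, h, Equiv.symm_apply_apply]
  simp
  ring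

/-- The iterated intrications `σ_1 = (0, 1)` and `σ_m = σ_{m-1} · (0, 1)` for `m ≥ 2`
(the value at `m = 0` is a placeholder). -/
def iteratedIntrication : (m : ℕ) → Equiv.Perm (Fin (2 ^ m))
  | 0 => 1
  | 1 => 1
  | m + 2 => (finCongr (pow_succ 2 (m + 1)).symm).permCongr
      (intrication (iteratedIntrication (m + 1)) (1 : Equiv.Perm (Fin 2)))

end VanDerCorput

end

/-!
Both parts follow from explicit formulas that involve the permutation only through `m`. Write
`tentSum M ω = ∑ k < M, ‖2 ^ k * ω‖`, with `‖·‖` the distance to the nearest integer. Then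
`psi σ x = tentSum m (fract x)` (`Family.psi_eq`), and if `N < 2 ^ (m * L)` and
`ω = N / 2 ^ (m * L)`, then `N * D_N = tentSum (m * L) ω + ω` (`Family.discrepancy_eq`). Since
`σ_m` and `(0, 1)` belong to the families `P_m` and `P_1`, the theorem follows by comparison.

The formulas come from one observation about weights on the cyclic group of order `2 ^ M`
(`Dyadic`). Call weights dyadic if, up to a translation, they vanish identically or equal `1`
identically on one parity class, and are dyadic at level `M - 1` on the other one. The centred sum
`G h = ∑ p < h, (w p - ω)`, with `ω` the mean weight, has an oscillation `max G - min G` that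
satisfies the recursion of `tentSum`, whatever translations occur (`Dyadic.oscillation`): on one
parity class `G` is the centred sum of the smaller weights, and the other class only raises its
maximum or only lowers its minimum by an amount determined by `ω`.

The first points of a permutation of `P_m`, or of the sequence it generates, have dyadic weights
(`Family.dyadic`, `Family.dyadic_rank`): the recursive definition of the family fills the even
residues before it starts on the odd ones, and the shift by `a`, with its carries, only translates
a smaller set of the same kind. The function `φ_{b,h}^σ x` is the centred sum at `h` for the
weights in which the last point counts with the fractional part of `b * x` (`phi_eq`), so `psi` is
its oscillation. The number `N * D_N` is the oscillation of the local discrepancy on the real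
circle, which exceeds that on the grid by `ω` (`discrepancy_eq`).
-/

namespace VanDerCorput

/-! ### Dyadic weights -/

/-- Periodic weights on `ℤ`, of period `2 ^ M` and mean value `ω`, built by repeated doubling: up
to a translation, the weights on one parity class are a smaller weight function of this kind, and
those on the other parity class are all `0` or all `1`. The integer `h` stands for the point
`h / 2 ^ M` of the circle. -/
inductive Dyadic : ℕ → ℝ → (ℤ → ℝ) → Prop
  | const (c : ℝ) (h0 : 0 ≤ c) (h1 : c ≤ 1) : Dyadic 0 c fun _ => c
  | sparse {M : ℕ} {ω : ℝ} {v w : ℤ → ℝ} (s : ℤ) (hv : Dyadic M ω v)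
      (h1 : ∀ j, w (2 * j + s) = v j) (h2 : ∀ j, w (2 * j + 1 + s) = 0) :
      Dyadic (M + 1) (ω / 2) w
  | dense {M : ℕ} {ω : ℝ} {v w : ℤ → ℝ} (s : ℤ) (hv : Dyadic M ω v)
      (h1 : ∀ j, w (2 * j + s) = 1) (h2 : ∀ j, w (2 * j + 1 + s) = v j) :
      Dyadic (M + 1) ((1 + ω) / 2) w

theorem Dyadic.translate {M : ℕ} {ω : ℝ} {w : ℤ → ℝ} (h : Dyadic M ω w) (t : ℤ) :
    Dyadic M ω fun z => w (z + t) := by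
  cases h with
  | const _ h0 h1 => exact .const _ h0 h1
  | sparse s hv h1 h2 =>
    refine .sparse (s - t) hv (fun j => ?_) (fun j => ?_)
    · rw [← h1]; congr 1; ring
    · rw [← h2 j]; congr 1; ring
  | dense s hv h1 h2 =>
    refine .dense (s - t) hv (fun j => ?_) (fun j => ?_)
    · rw [← h1 j]; congr 1; ring
    · rw [← h2]; congr 1; ring

theorem Dyadic.mean_mem {M : ℕ} {ω : ℝ} {w : ℤ → ℝ} (h : Dyadic M ω w) : 0 ≤ ω ∧ ω ≤ 1 := by
  induction h with
  | const c h0 h1 => exact ⟨h0, h1⟩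
  | sparse s hv h1 h2 ih => constructor <;> linarith [ih.1, ih.2]
  | dense s hv h1 h2 ih => constructor <;> linarith [ih.1, ih.2]

/-! ### The oscillation of centred sums of dyadic weights -/

/-- The sum `∑ k < M, ‖2 ^ k * ω‖`, where `‖·‖` is the distance to the nearest integer. -/
noncomputable def tentSum : ℕ → ℝ → ℝ
  | 0, _ => 0
  | M + 1, ω => |ω - round ω| + tentSum M (2 * ω)

theorem tentSum_add_intCast (M : ℕ) (ω : ℝ) (z : ℤ) : tentSum M (ω + z) = tentSum M ω := by
  induction M generalizing ω z with
  | zero => rfl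
  | succ M ih =>
    have h : 2 * (ω + z) = 2 * ω + ((2 * z : ℤ) : ℝ) := by push_cast; ring
    simp only [tentSum]
    rw [h, ih, round_add_intCast]
    push_cast
    ring_nf

theorem tentSum_succ_half {M : ℕ} {ω : ℝ} (h0 : 0 ≤ ω) (h1 : ω ≤ 1) :
    tentSum (M + 1) (ω / 2) = ω / 2 + tentSum M ω := by
  have hf : Int.fract (ω / 2) = ω / 2 := Int.fract_eq_self.2 ⟨by linarith, by linarith⟩
  have h2 : 2 * (ω / 2) = ω := by ring
  rw [tentSum, abs_sub_round_eq_min, hf, h2, min_eq_left (by linarith)]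

theorem tentSum_succ_half_add {M : ℕ} {ω : ℝ} (h0 : 0 ≤ ω) (h1 : ω ≤ 1) :
    tentSum (M + 1) ((1 + ω) / 2) = (1 - ω) / 2 + tentSum M ω := by
  have h2 : 2 * ((1 + ω) / 2) = ω + ((1 : ℤ) : ℝ) := by push_cast; ring
  rw [tentSum, h2, tentSum_add_intCast, abs_sub_round_eq_min]
  congr 1
  rcases h1.lt_or_eq with h | rfl
  · have hf : Int.fract ((1 + ω) / 2) = (1 + ω) / 2 :=
      Int.fract_eq_self.2 ⟨by linarith, by linarith⟩
    rw [hf, min_eq_right (by linarith)]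
    ring
  · norm_num

/-- A centred summation function of dyadic weights is periodic, and its oscillation depends only
on the level and on the mean value of the weights. In both doubling steps, the summation function
on one parity class is that of the smaller weights, and on the other class it is a translate of it:
above it by `ω / 2` in the sparse case, below it by `(1 - ω) / 2` in the dense case. -/
theorem Dyadic.oscillation {M : ℕ} {ω : ℝ} {w : ℤ → ℝ} (hw : Dyadic M ω w) (G : ℤ → ℝ)
    (hG : ∀ h, G (h + 1) = G h + w h - ω) :
    (∀ h, G (h + 2 ^ M) = G h) ∧
      ∃ u l, IsGreatest (Set.range G) u ∧ IsLeast (Set.range G) l ∧ u - l = tentSum M ω := by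
  induction hw generalizing G with
  | const c h0 h1 =>
    have hp : ∀ h, G (h + 1) = G h := fun h => by rw [hG]; ring
    have hc : ∀ h, G h = G 0 := fun h => by
      induction h using Int.induction_on with
      | zero => rfl
      | succ i ih => rw [hp, ih]
      | pred i ih => rw [← ih, ← hp (-(i : ℤ) - 1)]; congr 1; ring
    refine ⟨by simpa using hp, G 0, G 0, ⟨⟨0, rfl⟩, ?_⟩, ⟨⟨0, rfl⟩, ?_⟩, by simp [tentSum]⟩
    · rintro _ ⟨h, rfl⟩; exact (hc h).le
    · rintro _ ⟨h, rfl⟩; exact (hc h).ge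
  | @sparse M ω v w s hv h1 h2 ih =>
    obtain ⟨ω0, ω1⟩ := hv.mean_mem
    have e1 : ∀ j, G (2 * j + 1 + s) = G (2 * (j + 1) + s) + ω / 2 := fun j => by
      have := hG (2 * j + 1 + s)
      rw [h2] at this
      rw [show 2 * (j + 1) + s = 2 * j + 1 + s + 1 by ring, this]
      ring
    obtain ⟨hp, u, l, ⟨⟨ju, hu⟩, hu'⟩, ⟨⟨jl, hl⟩, hl'⟩, hul⟩ :=
      ih (fun j => G (2 * j + s)) fun j => by
      have := hG (2 * j + s)
      rw [h1, show 2 * j + s + 1 = 2 * j + 1 + s by ring, e1] at this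
      linarith
    have hu'' : ∀ j, G (2 * j + s) ≤ u := fun j => hu' ⟨j, rfl⟩
    have hl'' : ∀ j, l ≤ G (2 * j + s) := fun j => hl' ⟨j, rfl⟩
    have split : ∀ h : ℤ, ∃ j, h = 2 * j + s ∨ h = 2 * j + 1 + s := fun h =>
      ⟨(h - s) / 2, by omega⟩
    refine ⟨fun h => ?_, u + ω / 2, l, ⟨⟨2 * (ju - 1) + 1 + s, ?_⟩, ?_⟩, ⟨⟨2 * jl + s, hl⟩, ?_⟩, ?_⟩
    · obtain ⟨j, rfl | rfl⟩ := split h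
      · rw [← hp j]; congr 1; ring
      · rw [e1, ← hp (j + 1),
          show 2 * j + 1 + s + 2 ^ (M + 1) = 2 * (j + 2 ^ M) + 1 + s by ring, e1]
        congr 2; ring
    · rw [e1, ← hu]; simp
    · rintro _ ⟨h, rfl⟩
      obtain ⟨j, rfl | rfl⟩ := split h
      · linarith [hu'' j]
      · rw [e1]; linarith [hu'' (j + 1)]
    · rintro _ ⟨h, rfl⟩
      obtain ⟨j, rfl | rfl⟩ := split h
      · exact hl'' j
      · rw [e1]; linarith [hl'' (j + 1)]
    · rw [tentSum_succ_half ω0 ω1]; linarith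
  | @dense M ω v w s hv h1 h2 ih =>
    obtain ⟨ω0, ω1⟩ := hv.mean_mem
    have e1 : ∀ j, G (2 * j + s) = G (2 * j + 1 + s) - (1 - ω) / 2 := fun j => by
      have := hG (2 * j + s)
      rw [h1] at this
      rw [show 2 * j + 1 + s = 2 * j + s + 1 by ring, this]
      ring
    obtain ⟨hp, u, l, ⟨⟨ju, hu⟩, hu'⟩, ⟨⟨jl, hl⟩, hl'⟩, hul⟩ :=
      ih (fun j => G (2 * j + 1 + s)) fun j => by
        have := hG (2 * j + 1 + s)
        rw [h2, show 2 * j + 1 + s + 1 = 2 * (j + 1) + s by ring, e1] at this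
        linarith
    have hu'' : ∀ j, G (2 * j + 1 + s) ≤ u := fun j => hu' ⟨j, rfl⟩
    have hl'' : ∀ j, l ≤ G (2 * j + 1 + s) := fun j => hl' ⟨j, rfl⟩
    have split : ∀ h : ℤ, ∃ j, h = 2 * j + s ∨ h = 2 * j + 1 + s := fun h =>
      ⟨(h - s) / 2, by omega⟩
    refine ⟨fun h => ?_, u, l - (1 - ω) / 2, ⟨⟨2 * ju + 1 + s, hu⟩, ?_⟩, ⟨⟨2 * jl + s, ?_⟩, ?_⟩, ?_⟩
    · obtain ⟨j, rfl | rfl⟩ := split h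
      · rw [e1, ← hp j, show 2 * j + s + 2 ^ (M + 1) = 2 * (j + 2 ^ M) + s by ring, e1]
      · rw [← hp j]; congr 1; ring
    · rintro _ ⟨h, rfl⟩
      obtain ⟨j, rfl | rfl⟩ := split h
      · rw [e1]; linarith [hu'' j]
      · exact hu'' j
    · rw [e1, ← hl]
    · rintro _ ⟨h, rfl⟩
      obtain ⟨j, rfl | rfl⟩ := split h
      · rw [e1]; linarith [hl'' j]
      · linarith [hl'' j]
    · rw [tentSum_succ_half_add ω0 ω1]; linarith

theorem exists_centred_sum (w : ℤ → ℝ) (ω : ℝ) :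
    ∃ G : ℤ → ℝ, G 0 = 0 ∧ ∀ h, G (h + 1) = G h + w h - ω := by
  refine ⟨fun h => ∑ i ∈ Finset.range h.toNat, (w i - ω) -
    ∑ i ∈ Finset.range (-h).toNat, (w (-(i : ℤ) - 1) - ω), by simp, fun h => ?_⟩
  rcases h with n | n
  · have h1 : (Int.ofNat n + 1).toNat = n + 1 := by simp
    have h2 : (-(Int.ofNat n + 1)).toNat = 0 := by simp
    have h3 : (-(Int.ofNat n)).toNat = 0 := by simp
    simp only [h1, h2, h3, Finset.sum_range_succ]
    simp
    ring
  · have h1 : (Int.negSucc n + 1).toNat = 0 := by omega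
    have h2 : (-(Int.negSucc n + 1)).toNat = n := by omega
    have h3 : (-(Int.negSucc n)).toNat = n + 1 := by omega
    have h4 : (Int.negSucc n).toNat = 0 := by omega
    have h5 : -(n : ℤ) - 1 = Int.negSucc n := by omega
    simp only [h1, h2, h3, h4, Finset.sum_range_succ, h5]
    ring

/-! ### Permutations in the families -/

theorem entry_lt {b : ℕ} [NeZero b] (σ : Equiv.Perm (Fin b)) (i : ℕ) : entry σ i < b :=
  (σ _).isLt

theorem exists_entry_eq {b : ℕ} [NeZero b] (σ : Equiv.Perm (Fin b)) {r : ℕ} (hr : r < b) :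
    ∃ i < b, entry σ i = r :=
  ⟨σ.symm ⟨r, hr⟩, (σ.symm _).isLt, by simp [entry]⟩

theorem entry_inj {b : ℕ} [NeZero b] (σ : Equiv.Perm (Fin b)) {i j : ℕ} (hi : i < b) (hj : j < b) :
    entry σ i = entry σ j ↔ i = j := by
  simp [entry, Fin.val_inj, Fin.ext_iff, Nat.mod_eq_of_lt hi, Nat.mod_eq_of_lt hj]

theorem exists_eq_mul_add_entry {b : ℕ} [NeZero b] (σ : Equiv.Perm (Fin b)) (p : ℤ) :
    ∃ z : ℤ, ∃ k < b, p = b * z + entry σ k := by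
  have hb : (0 : ℤ) < b := by exact_mod_cast Nat.pos_of_ne_zero (NeZero.ne b)
  obtain ⟨k, hk, he⟩ := exists_entry_eq σ (r := (p % b).toNat)
    (by have := Int.emod_lt_of_pos p hb; omega)
  refine ⟨p / b, k, hk, ?_⟩
  rw [he, Int.toNat_of_nonneg (Int.emod_nonneg _ hb.ne'), Int.mul_ediv_add_emod]

/-- Weights of an initial segment of a permutation in the family, with `c` full residue classes
and one partial class: the class of `τ k` modulo `2 ^ m` is full for `k < c`, carries the dyadic
weights `v` for `k = c`, and is empty for `k > c`. -/
theorem Family.dyadic {m : ℕ} {τ : Equiv.Perm (Fin (2 ^ m))} (hτ : Family m τ) {M : ℕ} {ω : ℝ}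
    {v w : ℤ → ℝ} (hv : Dyadic M ω v) {c : ℕ} (hc : c < 2 ^ m)
    (hw : ∀ z : ℤ, ∀ k < 2 ^ m, w (2 ^ m * z + entry τ k) =
      if k < c then 1 else if k = c then v z else 0) :
    Dyadic (M + m) ((c + ω) / 2 ^ m) w := by
  induction hτ generalizing v w c with
  | one =>
    have h0 : ∀ z, w (2 * z) = if 0 < c then 1 else if 0 = c then v z else 0 := fun z => by
      simpa [entry] using hw z 0 (by norm_num)
    have h1 : ∀ z, w (2 * z + 1) = if 1 < c then 1 else if 1 = c then v z else 0 := fun z => by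
      simpa [entry] using hw z 1 (by norm_num)
    obtain rfl | rfl : c = 0 ∨ c = 1 := by omega
    · simpa using Dyadic.sparse (w := w) 0 hv (fun j => by simp [h0]) (fun j => by simp [h1])
    · simpa using Dyadic.dense (w := w) 0 hv (fun j => by simp [h0]) (fun j => by simp [h1])
  | step m σ σ' a τ hσ hσ' ha ha1 ha2 hfst hsnd ih ih' =>
    have hpow : 2 ^ (m + 1) = 2 * 2 ^ m := pow_succ' 2 m
    have hw1 : ∀ z : ℤ, ∀ k < 2 ^ m, w (2 * (2 ^ m * z + entry σ k)) =
        if k < c then 1 else if k = c then v z else 0 := fun z k hk => by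
      rw [← hw z k (by omega), hfst k hk]
      congr 1; push_cast; ring
    -- The reduction of `2 σ' k + a` modulo `2 ^ (m + 1)` translates the class by the carry.
    have hw2 : ∀ z : ℤ, ∀ k < 2 ^ m, w (2 * (2 ^ m * z + entry σ' k) + a) =
        if 2 ^ m + k < c then 1 else if 2 ^ m + k = c then
          v (z + ((2 * entry σ' k + a) / 2 ^ (m + 1) : ℕ)) else 0 := fun z k hk => by
      rw [← hw _ (2 ^ m + k) (by omega), hsnd k hk]
      have := congrArg (Nat.cast : ℕ → ℤ) (Nat.mod_add_div (2 * entry σ' k + a) (2 ^ (m + 1)))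
      generalize (2 * entry σ' k + a) % 2 ^ (m + 1) = r at *
      generalize (2 * entry σ' k + a) / 2 ^ (m + 1) = q at *
      push_cast at this ⊢
      congr 1
      linear_combination -this
    obtain ⟨s, hs⟩ := ha
    by_cases hcm : c < 2 ^ m
    · have := Dyadic.sparse (w := w) 0
        (ih (w := fun j => w (2 * j)) hv hcm hw1) (fun j => by simp) (fun j => by
          obtain ⟨z, k, hk, he⟩ := exists_eq_mul_add_entry σ' (j - s)
          have := hw2 z k hk
          rw [if_neg (by omega), if_neg (by omega)] at this
          rw [← this]
          congr 1
          push_cast at he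
          rw [← he, hs]
          push_cast
          ring)
      rwa [div_div, ← pow_succ] at this
    · obtain ⟨d, rfl⟩ := Nat.exists_eq_add_of_le (not_lt.1 hcm)
      have hd : d < 2 ^ m := by omega
      have := Dyadic.dense (w := w) (2 * s)
        (ih' (w := fun j => w (2 * j + a))
          (hv.translate ((2 * entry σ' d + a) / 2 ^ (m + 1) : ℕ)) hd (fun z k hk => by
            rw [hw2 z k hk]
            simp only [add_lt_add_iff_left, add_right_inj]
            split_ifs with h1 h2
            · rfl
            · rw [h2]
            · rfl)) (fun j => by
          obtain ⟨z, k, hk, he⟩ := exists_eq_mul_add_entry σ (j + s)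
          have := hw1 z k hk
          rw [if_pos (by omega)] at this
          rw [← this]
          congr 1
          push_cast at he
          rw [← he]; ring) (fun j => by
          congr 1
          rw [hs]; push_cast; ring)
      convert this using 1
      · rfl
      · rw [pow_succ]; push_cast; field_simp
        ring

theorem Family.entry_zero {m : ℕ} {τ : Equiv.Perm (Fin (2 ^ m))} (hτ : Family m τ) :
    entry τ 0 = 0 := by
  induction hτ with
  | one => simp [entry]
  | step m σ σ' a τ hσ hσ' ha ha1 ha2 hfst hsnd ih ih' => rw [hfst 0 (by positivity), ih]

theorem entry_iteratedIntrication_succ (m i q : ℕ) (hi : i < 2 ^ (m + 1)) (hq : q < 2) :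
    entry (iteratedIntrication (m + 2)) (q * 2 ^ (m + 1) + i) =
      2 * entry (iteratedIntrication (m + 1)) i + q := by
  have hlt : q * 2 ^ (m + 1) + i < 2 ^ (m + 2) := by
    rw [pow_succ 2 (m + 1)]; nlinarith
  have := intrication_apply (iteratedIntrication (m + 1)) (1 : Equiv.Perm (Fin 2))
    ((finCongr (pow_succ 2 (m + 1))) (Fin.ofNat _ (q * 2 ^ (m + 1) + i)))
    (Fin.ofNat _ i) ⟨q, hq⟩ (by simp [Nat.mod_eq_of_lt hi, Nat.mod_eq_of_lt hlt])
  simpa [entry, iteratedIntrication, Equiv.permCongr_apply] using this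

theorem family_iteratedIntrication (m : ℕ) : Family (m + 1) (iteratedIntrication (m + 1)) := by
  induction m with
  | zero => exact .one
  | succ m ih =>
    refine .step _ _ _ 1 _ ih ih odd_one le_rfl Nat.one_le_two_pow (fun i hi => ?_) fun i hi => ?_
    · simpa using entry_iteratedIntrication_succ m i 0 hi (by norm_num)
    · have h := entry_iteratedIntrication_succ m i 1 hi (by norm_num)
      have := entry_lt (iteratedIntrication (m + 1)) i
      rw [one_mul] at h
      rw [h, Nat.mod_eq_of_lt]
      rw [pow_succ 2 (m + 1)]; omega

/-! ### Initial segments of permuted van der Corput sequences -/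

theorem count_eq_card (α β : ℝ) (N : ℕ) (x : ℕ → ℝ) [DecidablePred fun i => α ≤ x i ∧ x i < β] :
    count α β N x = ((Finset.range N).filter fun i => α ≤ x i ∧ x i < β).card :=
  Nat.subtype_card _ (by simp)

/-- The index, among the first `b ^ L` points of the permuted van der Corput sequence, of the point
`z / b ^ L` modulo `1`: the inverse of `σ` is applied to the last `L` digits of `z`, whose order is
then reversed. -/
def rank {b : ℕ} [NeZero b] (σ : Equiv.Perm (Fin b)) : ℕ → ℤ → ℕ
  | 0, _ => 0
  | L + 1, z => (σ.symm (Fin.ofNat b (z % b).toNat) : ℕ) * b ^ L + rank σ L (z / b)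

section Rank

variable {b : ℕ} [NeZero b] (σ : Equiv.Perm (Fin b))

theorem rank_succ (L : ℕ) (z : ℤ) {k : ℕ} (hk : k < b) :
    rank σ (L + 1) (b * z + entry σ k) = k * b ^ L + rank σ L z := by
  have hb : (b : ℤ) ≠ 0 := by exact_mod_cast NeZero.ne b
  have he := entry_lt σ k
  have hm : ((b : ℤ) * z + entry σ k) % b = entry σ k := by
    rw [Int.mul_add_emod_self_left]
    exact Int.emod_eq_of_lt (by positivity) (by exact_mod_cast he)
  have hd : ((b : ℤ) * z + entry σ k) / b = z := by
    rw [Int.mul_add_ediv_left _ _ hb, Int.ediv_eq_zero_of_lt (by positivity) (by exact_mod_cast he),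
      add_zero]
  rw [rank, hm, hd]
  simp [entry, Nat.mod_eq_of_lt hk]

theorem rank_lt (L : ℕ) (z : ℤ) : rank σ L z < b ^ L := by
  induction L generalizing z with
  | zero => simp [rank]
  | succ L ih =>
    obtain ⟨z, k, hk, rfl⟩ := exists_eq_mul_add_entry σ z
    rw [rank_succ σ L z hk, pow_succ]
    nlinarith [ih z]

theorem exists_rank_eq (L : ℕ) {n : ℕ} (hn : n < b ^ L) :
    ∃ p : ℤ, 0 ≤ p ∧ p < b ^ L ∧ rank σ L p = n := by
  induction L generalizing n with
  | zero => exact ⟨0, le_rfl, by simp, by simp [rank] at hn ⊢; omega⟩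
  | succ L ih =>
    have hpos : 0 < b ^ L := pow_pos (Nat.pos_of_ne_zero (NeZero.ne b)) L
    obtain ⟨z, hz0, hz1, hz⟩ := ih (Nat.mod_lt n hpos)
    have hk : n / b ^ L < b := Nat.div_lt_of_lt_mul (by rwa [← pow_succ])
    have he : (entry σ (n / b ^ L) : ℤ) < b := by exact_mod_cast entry_lt σ _
    refine ⟨b * z + entry σ (n / b ^ L), by positivity, ?_, ?_⟩
    · rw [pow_succ]; nlinarith
    · rw [rank_succ σ L z hk, hz, mul_comm, Nat.div_add_mod]

theorem digit_mul_pow_add {k L q j : ℕ} (hj : j < L) :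
    digit b (k * b ^ L + q) j = digit b q j := by
  have hb : 0 < b := Nat.pos_of_ne_zero (NeZero.ne b)
  obtain ⟨i, rfl⟩ := Nat.exists_eq_add_of_lt hj
  have : k * b ^ (j + i + 1) + q = b ^ j * (b * (k * b ^ i)) + q := by ring
  rw [digit, digit, this, Nat.mul_add_div (by positivity), Nat.mul_add_mod]

theorem sum_digits_rank (L : ℕ) {p : ℤ} (hp0 : 0 ≤ p) (hp1 : p < b ^ L) :
    ∑ j ∈ Finset.range L, (entry σ (digit b (rank σ L p) j) : ℝ) / (b : ℝ) ^ (j + 1) =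
      p / (b : ℝ) ^ L := by
  have hb : 0 < b := Nat.pos_of_ne_zero (NeZero.ne b)
  induction L generalizing p with
  | zero =>
    obtain rfl : p = 0 := by simp at hp1; omega
    simp
  | succ L ih =>
    obtain ⟨z, k, hk, rfl⟩ := exists_eq_mul_add_entry σ p
    have he : (entry σ k : ℤ) < b := by exact_mod_cast entry_lt σ k
    have hz0 : 0 ≤ z := by
      by_contra h
      nlinarith [show z + 1 ≤ 0 by omega]
    have hz1 : z < b ^ L := by
      rw [pow_succ] at hp1
      by_contra h
      nlinarith [not_lt.1 h, (Nat.cast_nonneg (entry σ k) : (0 : ℤ) ≤ _)]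
    have hd : digit b (k * b ^ L + rank σ L z) L = k := by
      rw [digit, mul_comm, Nat.mul_add_div (by positivity), Nat.div_eq_of_lt (rank_lt σ L z),
        add_zero, Nat.mod_eq_of_lt hk]
    rw [rank_succ σ L z hk, Finset.sum_range_succ, hd, Finset.sum_congr rfl fun j hj => by
      rw [digit_mul_pow_add (Finset.mem_range.1 hj)], ih hz0 hz1]
    push_cast
    field_simp
    ring

theorem permutedRadicalInverse_rank (h0 : entry σ 0 = 0) (L : ℕ) {p : ℤ} (hp0 : 0 ≤ p)
    (hp1 : p < b ^ L) : permutedRadicalInverse σ (rank σ L p) = p / (b : ℝ) ^ L := by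
  rw [← sum_digits_rank σ L hp0 hp1, permutedRadicalInverse, tsum_eq_sum]
  intro j hj
  have hj : L ≤ j := by simpa using hj
  have hb : 0 < b := Nat.pos_of_ne_zero (NeZero.ne b)
  rw [digit, Nat.div_eq_of_lt ((rank_lt σ L p).trans_le (Nat.pow_le_pow_right hb hj)), Nat.zero_mod,
    h0]
  simp

theorem count_permutedRadicalInverse (h0 : entry σ 0 = 0) {L N : ℕ} (hN : N ≤ b ^ L) {α β : ℝ}
    (hα : 0 ≤ α) (hβ : β ≤ 1) :
    (count α β N (permutedRadicalInverse σ) : ℝ) =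
      ∑ p ∈ Finset.Ico ⌈α * (b : ℝ) ^ L⌉ ⌈β * (b : ℝ) ^ L⌉,
        if rank σ L p < N then (1 : ℝ) else 0 := by
  classical
  have hb : (0 : ℝ) < (b : ℝ) ^ L := by
    have := Nat.pos_of_ne_zero (NeZero.ne b)
    positivity
  have hp0 : ∀ p : ℤ, ⌈α * (b : ℝ) ^ L⌉ ≤ p → 0 ≤ p := fun p h =>
    (Int.ceil_nonneg (by positivity)).trans h
  have hp1 : ∀ p : ℤ, p < ⌈β * (b : ℝ) ^ L⌉ → p < (b : ℤ) ^ L := fun p h => by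
    have h1 := (Int.lt_ceil.1 h).trans_le (mul_le_mul_of_nonneg_right hβ hb.le)
    rw [one_mul] at h1
    exact_mod_cast h1
  rw [Finset.sum_boole, count_eq_card]
  congr 1
  symm
  refine Finset.card_bij (fun p _ => rank σ L p) ?_ ?_ ?_
  · intro p hp
    simp only [Finset.mem_filter, Finset.mem_Ico, Finset.mem_range] at hp ⊢
    rw [permutedRadicalInverse_rank σ h0 L (hp0 p hp.1.1) (hp1 p hp.1.2), le_div_iff₀ hb,
      div_lt_iff₀ hb]
    exact ⟨hp.2, Int.ceil_le.1 hp.1.1, Int.lt_ceil.1 hp.1.2⟩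
  · intro p hp q hq hpq
    simp only [Finset.mem_filter, Finset.mem_Ico] at hp hq
    have h1 := permutedRadicalInverse_rank σ h0 L (hp0 p hp.1.1) (hp1 p hp.1.2)
    rw [hpq, permutedRadicalInverse_rank σ h0 L (hp0 q hq.1.1) (hp1 q hq.1.2),
      div_left_inj' hb.ne'] at h1
    exact_mod_cast h1.symm
  · intro n hn
    simp only [Finset.mem_filter, Finset.mem_range] at hn
    obtain ⟨p, h1, h2, rfl⟩ := exists_rank_eq σ L (hn.1.trans_le hN)
    rw [permutedRadicalInverse_rank σ h0 L h1 h2, le_div_iff₀ hb, div_lt_iff₀ hb] at hn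
    exact ⟨p, by simpa [Int.ceil_le, Int.lt_ceil] using ⟨hn.2, hn.1⟩, rfl⟩

end Rank

/-- The indicator of the first `N` points of the permuted van der Corput sequence is dyadic. By
the leading digit of the indices, these points consist of full residue classes modulo `2 ^ m` and
an initial segment, on a smaller scale, of one further class. -/
theorem Family.dyadic_rank {m : ℕ} {σ : Equiv.Perm (Fin (2 ^ m))} (hσ : Family m σ) (L : ℕ) {N : ℕ}
    (hN : N < (2 ^ m) ^ L) :
    Dyadic (m * L) (N / 2 ^ (m * L)) fun z => if rank σ L z < N then 1 else 0 := by
  induction L generalizing N with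
  | zero =>
    obtain rfl : N = 0 := by simpa using hN
    simpa using Dyadic.const 0 le_rfl zero_le_one
  | succ L ih =>
    have hpos : 0 < (2 ^ m) ^ L := by positivity
    have := hσ.dyadic (ih (Nat.mod_lt N hpos))
      (w := fun z => if rank σ (L + 1) z < N then 1 else 0)
      (Nat.div_lt_of_lt_mul (by rwa [← pow_succ])) (fun z k hk => by
        have h1 := rank_succ σ L z hk
        rw [Nat.cast_pow, Nat.cast_ofNat] at h1
        rw [h1]
        have h2 := rank_lt σ L z
        have h3 := Nat.div_add_mod N ((2 ^ m) ^ L)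
        have h4 := Nat.mod_lt N hpos
        generalize N / (2 ^ m) ^ L = c at *
        generalize N % (2 ^ m) ^ L = r at *
        generalize (2 ^ m) ^ L = K at *
        generalize rank σ L z = q at *
        subst h3
        rcases lt_trichotomy k c with h | rfl | h
        · rw [if_pos h, if_pos (by nlinarith)]
        · rw [if_neg (lt_irrefl _), if_pos rfl, mul_comm K]
          simp
        · rw [if_neg h.not_gt, if_neg h.ne', if_neg (by nlinarith)])
    rw [Nat.mul_succ]
    convert this using 1
    have h3 : (N : ℝ) = (2 ^ m) ^ L * (N / (2 ^ m) ^ L : ℕ) + (N % (2 ^ m) ^ L : ℕ) := by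
      exact_mod_cast (Nat.div_add_mod N ((2 ^ m) ^ L)).symm
    rw [pow_add, h3, pow_mul]
    field_simp

/-! ### The extreme discrepancy -/

theorem eq_emod_of_periodic {G : ℤ → ℝ} {K : ℤ} (hG : ∀ h, G (h + K) = G h) (z : ℤ) :
    G (z % K) = G z := by
  have h : Function.Periodic G K := hG
  rw [Int.emod_def, mul_comm]
  exact h.sub_zsmul_eq (z / K)

theorem sum_Ico_eq_sub {G w : ℤ → ℝ} {ω : ℝ} (hG : ∀ h, G (h + 1) = G h + w h - ω) {e h : ℤ}
    (heh : e ≤ h) : ∑ p ∈ Finset.Ico e h, w p = G h - G e + ω * (h - e) := by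
  induction h, heh using Int.leInduction with
  | base => simp
  | succ h heh ih =>
    rw [← Finset.insert_Ico_right_eq_Ico_add_one heh, Finset.sum_insert (by simp), ih, hG]
    push_cast
    ring

/-- If the points counted by `N * D_N` lie at multiples of `2 ^ (-M)` and are described by dyadic
weights, then `N * D_N` is the oscillation of their local discrepancy on the circle. On the grid it
is `tentSum M ω`; the supremum over real intervals exceeds this by `ω = N / 2 ^ M`: moving the
right endpoint from `h / 2 ^ M` to just above `(h - 1) / 2 ^ M` loses no point. -/
theorem discrepancy_eq {M : ℕ} {ω : ℝ} {w : ℤ → ℝ} (hw : Dyadic M ω w) {N : ℕ} {x : ℕ → ℝ}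
    (hω : ω = N / 2 ^ M)
    (hc : ∀ α β : ℝ, 0 ≤ α → β ≤ 1 → (count α β N x : ℝ) =
      ∑ p ∈ Finset.Ico ⌈α * 2 ^ M⌉ ⌈β * 2 ^ M⌉, w p) :
    discrepancy N x = (tentSum M ω + ω) / N := by
  obtain ⟨ω0, ω1⟩ := hw.mean_mem
  obtain ⟨G, -, hG⟩ := exists_centred_sum w ω
  obtain ⟨hper, u, l, ⟨⟨ju, rfl⟩, hu⟩, ⟨⟨jl, rfl⟩, hl⟩, hul⟩ := hw.oscillation G hG
  have hu : ∀ h, G h ≤ G ju := fun h => hu ⟨h, rfl⟩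
  have hl : ∀ h, G jl ≤ G h := fun h => hl ⟨h, rfl⟩
  have hK : (0 : ℝ) < 2 ^ M := by positivity
  have hNK : (N : ℝ) = ω * 2 ^ M := by rw [hω]; field_simp
  have hR : ∀ α β : ℝ, 0 ≤ α → α ≤ β → β ≤ 1 → remainder α β N x =
      G ⌈β * 2 ^ M⌉ - G ⌈α * 2 ^ M⌉ +
        ω * ((⌈β * 2 ^ M⌉ - β * 2 ^ M) - (⌈α * 2 ^ M⌉ - α * 2 ^ M)) := by
    intro α β h0 h1 h2
    rw [remainder, hc α β h0 h2, sum_Ico_eq_sub hG (Int.ceil_mono (by gcongr)), hNK]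
    ring
  rw [discrepancy]
  congr 1
  rw [← hul]
  refine IsLUB.csSup_eq ⟨?_, ?_⟩ ⟨_, 0, 1, le_rfl, one_pos, le_rfl, rfl⟩
  · rintro _ ⟨α, β, h0, h1, h2, rfl⟩
    rw [hR α β h0 h1.le h2]
    have a1 := Int.le_ceil (β * 2 ^ M)
    have a2 := Int.ceil_lt_add_one (β * 2 ^ M)
    have a3 := Int.le_ceil (α * 2 ^ M)
    have a4 := Int.ceil_lt_add_one (α * 2 ^ M)
    have b1 := hu ⌈β * 2 ^ M⌉
    have b2 := hl ⌈β * 2 ^ M⌉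
    have b3 := hu ⌈α * 2 ^ M⌉
    have b4 := hl ⌈α * 2 ^ M⌉
    have key : |((⌈β * 2 ^ M⌉ - β * 2 ^ M) - (⌈α * 2 ^ M⌉ - α * 2 ^ M) : ℝ)| ≤ 1 :=
      abs_le.2 ⟨by linarith, by linarith⟩
    refine (abs_add_le _ _).trans (add_le_add (abs_le.2 ⟨by linarith, by linarith⟩) ?_)
    rw [abs_mul, abs_of_nonneg ω0]
    exact mul_le_of_le_one_right ω0 key
  · intro B hB
    -- Representatives of the extremal grid points with `0 ≤ e < 2 ^ M` and `1 ≤ h ≤ 2 ^ M`.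
    have hKz : (0 : ℤ) < 2 ^ M := by positivity
    obtain ⟨e, he0, he1, he⟩ : ∃ e : ℤ, 0 ≤ e ∧ e < 2 ^ M ∧ G e = G jl :=
      ⟨jl % 2 ^ M, Int.emod_nonneg _ hKz.ne', Int.emod_lt_of_pos _ hKz,
        eq_emod_of_periodic hper jl⟩
    obtain ⟨h, hh0, hh1, hh⟩ : ∃ h : ℤ, 1 ≤ h ∧ h ≤ 2 ^ M ∧ G h = G ju := by
      refine ⟨(ju - 1) % 2 ^ M + 1, ?_, ?_, ?_⟩
      · linarith [Int.emod_nonneg (ju - 1) hKz.ne']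
      · linarith [Int.emod_lt_of_pos (ju - 1) hKz]
      · have := eq_emod_of_periodic (G := fun z => G (z + 1)) (K := 2 ^ M)
          (fun z => by rw [← hper (z + 1)]; congr 1; ring) (ju - 1)
        simpa using this
    have he1' : (e : ℝ) < 2 ^ M := by exact_mod_cast he1
    have he0' : (0 : ℝ) ≤ e := by exact_mod_cast he0
    have hh1' : (h : ℝ) ≤ 2 ^ M := by exact_mod_cast hh1
    have hh0' : (1 : ℝ) ≤ h := by exact_mod_cast hh0
    -- Up to complements, the intervals that run from the minimum of `G` to just after the grid
    -- point that precedes its maximum.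
    have approx : ∀ ε : ℝ, 0 < ε → ε < 1 → G ju - G jl + ω * (1 - ε) ≤ B := by
      intro ε ε0 ε1
      have c1 : ⌈((h - 1 + ε) / 2 ^ M : ℝ) * 2 ^ M⌉ = h := by
        rw [div_mul_cancel₀ _ hK.ne', Int.ceil_eq_iff]
        constructor <;> linarith
      have c2 : ⌈(e / 2 ^ M : ℝ) * 2 ^ M⌉ = e := by
        rw [div_mul_cancel₀ _ hK.ne', Int.ceil_intCast]
      rcases lt_or_ge e h with heh | heh
      · have heh' : (e : ℝ) + 1 ≤ h := by exact_mod_cast heh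
        have hlt : (e / 2 ^ M : ℝ) < (h - 1 + ε) / 2 ^ M := by gcongr; linarith
        have hle : (h - 1 + ε : ℝ) / 2 ^ M ≤ 1 := (div_le_one hK).2 (by linarith)
        refine le_trans ?_ (hB ⟨e / 2 ^ M, (h - 1 + ε) / 2 ^ M, by positivity, hlt, hle, rfl⟩)
        rw [hR _ _ (by positivity) hlt.le hle, c1, c2, div_mul_cancel₀ _ hK.ne',
          div_mul_cancel₀ _ hK.ne', he, hh]
        refine le_trans (le_of_eq ?_) (le_abs_self _)
        ring
      · have heh' : (h : ℝ) ≤ e := by exact_mod_cast heh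
        have hlt : (h - 1 + ε : ℝ) / 2 ^ M < e / 2 ^ M := by gcongr; linarith
        have hle : (e : ℝ) / 2 ^ M ≤ 1 := (div_le_one hK).2 he1'.le
        have hnn : (0 : ℝ) ≤ (h - 1 + ε) / 2 ^ M := div_nonneg (by linarith) hK.le
        refine le_trans ?_ (hB ⟨(h - 1 + ε) / 2 ^ M, e / 2 ^ M, hnn, hlt, hle, rfl⟩)
        rw [hR _ _ hnn hlt.le hle, c1, c2, div_mul_cancel₀ _ hK.ne',
          div_mul_cancel₀ _ hK.ne', he, hh]
        refine le_trans (le_of_eq ?_) (neg_le_abs _)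
        ring
    have hlim : Filter.Tendsto (fun ε : ℝ => G ju - G jl + ω * (1 - ε)) (nhdsWithin 0 (Set.Ioi 0))
        (nhds (G ju - G jl + ω * (1 - 0))) := by
      apply Filter.Tendsto.mono_left _ nhdsWithin_le_nhds
      exact Continuous.tendsto (by fun_prop) 0
    rw [sub_zero, mul_one] at hlim
    refine le_of_tendsto hlim ?_
    filter_upwards [Ioo_mem_nhdsGT (one_pos (α := ℝ))] with ε hε
    exact approx ε hε.1 hε.2

theorem Family.discrepancy_eq {m : ℕ} {σ : Equiv.Perm (Fin (2 ^ m))} (hσ : Family m σ) {L N : ℕ}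
    (hN : N < (2 ^ m) ^ L) :
    discrepancy N (permutedRadicalInverse σ) =
      (tentSum (m * L) (N / 2 ^ (m * L)) + N / 2 ^ (m * L)) / N :=
  VanDerCorput.discrepancy_eq (hσ.dyadic_rank L hN) rfl fun α β hα hβ => by
    rw [count_permutedRadicalInverse σ hσ.entry_zero hN.le hα hβ]
    simp [pow_mul]

theorem radicalInverse_two :
    radicalInverse 2 = permutedRadicalInverse (1 : Equiv.Perm (Fin (2 ^ 1))) := by
  funext n
  simp [radicalInverse, permutedRadicalInverse, entry, digit]

/-! ### The functions `phi` and `psi` -/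

section Phi

variable {b : ℕ} [NeZero b] (σ : Equiv.Perm (Fin b))

theorem count_zero_pointTuple (h k : ℕ) :
    (count 0 ((h : ℝ) / b) k (pointTuple σ) : ℝ) =
      ∑ i ∈ Finset.range k, if entry σ i < h then (1 : ℝ) else 0 := by
  classical
  have hb : (0 : ℝ) < b := by exact_mod_cast Nat.pos_of_ne_zero (NeZero.ne b)
  rw [count_eq_card, Finset.sum_boole]
  congr 2
  ext i
  simp only [pointTuple, div_lt_div_iff_of_pos_right hb, Nat.cast_lt, Finset.mem_filter]
  have : 0 ≤ (entry σ i : ℝ) / b := by positivity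
  tauto

theorem count_one_pointTuple (h k : ℕ) :
    (count ((h : ℝ) / b) 1 k (pointTuple σ) : ℝ) =
      k - ∑ i ∈ Finset.range k, if entry σ i < h then (1 : ℝ) else 0 := by
  classical
  have hb : (0 : ℝ) < b := by exact_mod_cast Nat.pos_of_ne_zero (NeZero.ne b)
  rw [count_eq_card, ← Finset.sum_boole, eq_sub_iff_add_eq, ← Finset.sum_add_distrib]
  rw [Finset.sum_congr rfl (g := fun _ => (1 : ℝ))]
  · simp
  · intro i _
    have h1 : pointTuple σ i < 1 := (div_lt_one hb).2 (by exact_mod_cast entry_lt σ i)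
    have h2 : (h : ℝ) / b ≤ pointTuple σ i ↔ ¬ entry σ i < h := by
      rw [pointTuple, div_le_div_iff_of_pos_right hb, Nat.cast_le, not_lt]
    by_cases h3 : entry σ i < h <;> simp [h1, h2, h3]

/-- Both branches of `φ_{b,h}^σ` are the centred sum over the grid points below `h / b`, the first
`k - 1` points having weight `1` and the `k`-th point having the fractional part of `b * x`. -/
theorem phi_eq (h : ℕ) (x : ℝ) :
    phi σ h x = (∑ i ∈ Finset.range (⌊(b : ℝ) * Int.fract x⌋₊ + 1),
      if entry σ i < h then (1 : ℝ) else 0) - h * Int.fract x -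
        if entry σ ⌊(b : ℝ) * Int.fract x⌋₊ < h then
          1 - ((b : ℝ) * Int.fract x - ⌊(b : ℝ) * Int.fract x⌋₊) else 0 := by
  rw [phi, phiPiece, count_zero_pointTuple, count_one_pointTuple, Nat.add_sub_cancel]
  by_cases h1 : entry σ ⌊(b : ℝ) * Int.fract x⌋₊ < h
  · rw [if_neg h1.not_ge, if_pos h1]; push_cast; ring
  · rw [if_pos (not_lt.1 h1), if_neg h1]; ring

theorem phi_zero (x : ℝ) : phi σ 0 x = 0 := by simp [phi_eq]

theorem phi_entry_add_one {k : ℕ} (hk : k < b) (x : ℝ) :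
    phi σ (entry σ k + 1) x = phi σ (entry σ k) x +
      (if k < ⌊(b : ℝ) * Int.fract x⌋₊ then 1 else if k = ⌊(b : ℝ) * Int.fract x⌋₊ then
        (b : ℝ) * Int.fract x - ⌊(b : ℝ) * Int.fract x⌋₊ else 0) - Int.fract x := by
  have hb : (0 : ℝ) < b := by exact_mod_cast Nat.pos_of_ne_zero (NeZero.ne b)
  have hc : ⌊(b : ℝ) * Int.fract x⌋₊ < b := by
    rw [Nat.floor_lt (mul_nonneg hb.le (Int.fract_nonneg x))]
    nlinarith [Int.fract_lt_one x]
  rw [phi_eq, phi_eq]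
  generalize (b : ℝ) * Int.fract x - ⌊(b : ℝ) * Int.fract x⌋₊ = θ at *
  generalize ⌊(b : ℝ) * Int.fract x⌋₊ = c at *
  have h1 : ∀ i < b, (if entry σ i < entry σ k + 1 then (1 : ℝ) else 0) =
      (if entry σ i < entry σ k then 1 else 0) + if i = k then 1 else 0 := fun i hi => by
    simp only [← entry_inj σ hi hk]
    rcases lt_trichotomy (entry σ i) (entry σ k) with h | h | h
    · rw [if_pos (by omega), if_pos h, if_neg h.ne, add_zero]
    · simp [h]
    · rw [if_neg (by omega), if_neg h.not_gt, if_neg h.ne', add_zero]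
  have h2 : (if entry σ c < entry σ k + 1 then 1 - θ else 0) =
      (if entry σ c < entry σ k then 1 - θ else 0) + if c = k then 1 - θ else 0 := by
    have := congrArg (· * (1 - θ)) (h1 c hc)
    simpa [add_mul, ite_mul] using this
  rw [h2, Finset.sum_congr rfl fun i hi => h1 i (by have := Finset.mem_range.1 hi; omega),
    Finset.sum_add_distrib, Finset.sum_ite_eq']
  simp only [Finset.mem_range]
  push_cast
  rcases lt_trichotomy k c with h | rfl | h
  · rw [if_pos (by omega), if_neg h.ne', if_pos h]; ring
  · simp only [lt_add_one, lt_irrefl, if_true, if_false]; ring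
  · rw [if_neg (by omega), if_neg h.ne, if_neg h.not_gt, if_neg h.ne']; ring

end Phi

theorem Family.psi_eq {m : ℕ} {σ : Equiv.Perm (Fin (2 ^ m))} (hσ : Family m σ) (x : ℝ) :
    psi σ x = tentSum m (Int.fract x) := by
  have hf0 := Int.fract_nonneg x
  have hf1 := Int.fract_lt_one x
  set c : ℕ := ⌊((2 ^ m : ℕ) : ℝ) * Int.fract x⌋₊ with hc
  have hc1 : (c : ℝ) ≤ ((2 ^ m : ℕ) : ℝ) * Int.fract x := Nat.floor_le (by positivity)
  have hc2 : ((2 ^ m : ℕ) : ℝ) * Int.fract x < c + 1 := Nat.lt_floor_add_one _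
  have hcb : c < 2 ^ m := by
    rw [hc, Nat.floor_lt (by positivity)]
    exact mul_lt_of_lt_one_right (by positivity) hf1
  set θ : ℝ := ((2 ^ m : ℕ) : ℝ) * Int.fract x - c with hθ
  have hrank : ∀ z : ℤ, ∀ k < 2 ^ m, rank σ 1 (2 ^ m * z + entry σ k) = k := fun z k hk => by
    simpa [rank] using rank_succ σ 0 z hk
  have hw : Dyadic m (Int.fract x)
      fun z => if rank σ 1 z < c then 1 else if rank σ 1 z = c then θ else 0 := by
    have := hσ.dyadic (Dyadic.const θ (by linarith) (by linarith)) hcb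
      (w := fun z => if rank σ 1 z < c then 1 else if rank σ 1 z = c then θ else 0)
      (fun z k hk => by simp only [hrank z k hk])
    rw [zero_add] at this
    convert this using 1
    rw [hθ]; push_cast; field_simp; ring
  obtain ⟨G, hG0, hG⟩ := exists_centred_sum _ (Int.fract x)
  obtain ⟨hper, u, l, ⟨⟨ju, rfl⟩, hu⟩, ⟨⟨jl, rfl⟩, hl⟩, hul⟩ := hw.oscillation G hG
  have hphi : ∀ h ≤ 2 ^ m, phi σ h x = G h := fun h hh => by
    induction h with
    | zero => rw [phi_zero, Nat.cast_zero, hG0]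
    | succ h ih =>
      obtain ⟨k, hk, rfl⟩ := exists_entry_eq σ hh
      have := hrank 0 k hk
      rw [mul_zero, zero_add] at this
      rw [phi_entry_add_one σ hk, ih (by omega), Nat.cast_add, Nat.cast_one, hG, this]
  have hrep : ∀ z, ∃ h : Fin (2 ^ m), phi σ h x = G z := fun z => by
    have hK : (0 : ℤ) < 2 ^ m := by positivity
    have h0 := Int.emod_nonneg z hK.ne'
    have h1 := Int.emod_lt_of_pos z hK
    refine ⟨⟨(z % 2 ^ m).toNat, by zify; rw [Int.toNat_of_nonneg h0]; exact_mod_cast h1⟩, ?_⟩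
    rw [hphi _ (Fin.isLt _).le, ← eq_emod_of_periodic hper z, Int.toNat_of_nonneg h0]
  have hplus : psiPlus σ x = G ju := by
    obtain ⟨h, hh⟩ := hrep ju
    refine le_antisymm (Finset.sup'_le _ _ fun i _ => ?_) ?_
    · rw [hphi i i.isLt.le]; exact hu ⟨_, rfl⟩
    · rw [← hh]; exact Finset.le_sup' (fun h : Fin (2 ^ m) => phi σ h x) (Finset.mem_univ h)
  have hminus : psiMinus σ x = -G jl := by
    obtain ⟨h, hh⟩ := hrep jl
    refine le_antisymm (Finset.sup'_le _ _ fun i _ => ?_) ?_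
    · rw [hphi i i.isLt.le]; exact neg_le_neg (hl ⟨_, rfl⟩)
    · rw [← hh]; exact Finset.le_sup' (fun h : Fin (2 ^ m) => -phi σ h x) (Finset.mem_univ h)
  rw [psi, hplus, hminus, ← hul, sub_eq_add_neg]

end VanDerCorput

theorem mainTheorem4 (m : ℕ) (hm : 1 ≤ m) (σ : Equiv.Perm (Fin (2 ^ m)))
    (hσ : VanDerCorput.Family m σ) :
    (∀ x ∈ Set.Icc (0 : ℝ) 1,
      VanDerCorput.psi σ x = VanDerCorput.psi (VanDerCorput.iteratedIntrication m) x) ∧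
    ∀ N : ℕ, 1 ≤ N →
      VanDerCorput.discrepancy N (VanDerCorput.permutedRadicalInverse σ) =
        VanDerCorput.discrepancy N (VanDerCorput.radicalInverse 2) := by
  refine ⟨fun x _ => ?_, fun N _ => ?_⟩
  · obtain ⟨k, rfl⟩ := Nat.exists_eq_add_of_le' hm
    rw [hσ.psi_eq, (VanDerCorput.family_iteratedIntrication k).psi_eq]
  · have hN : N < (2 ^ m) ^ N := N.lt_pow_self (Nat.one_lt_two_pow (by omega))
    rw [hσ.discrepancy_eq hN, VanDerCorput.radicalInverse_two,
      VanDerCorput.Family.one.discrepancy_eq (L := m * N) (by rwa [pow_one, pow_mul]), one_mul]
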